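/- Consider a Markov decision process with a finite set of states $\mathcal S$, a finite nonempty set of actions $\mathcal A$, transition probabilities $\mathcal P(s,a,s')$, real rewards $r(s,a)$ and an initial state $s_0$, over an infinite horizon. A policy $\pi$ chooses, at each time $t$, a probability distribution over actions as a function of the history $(s_0,a_0,\dots,s_{t-1},a_{t-1},s_t)$. The wealth level of a finite history is $\sum_{i<t} r(s_i,a_i)$, and that of an infinite history is $W=\sum_{i=0}^{\infty} r(s_i,a_i)\in[-\infty,+\infty]$ (well defined when all rewards have the same sign). A policy is stationary deterministic wealth-Markovian if there is a single function $\delta:\mathcal S\times\mathbb R\to\mathcal A$ such that at every time $t$ it plays $\delta(s_t,w_t)$, where $w_t=\sum_{i<t} r(s_i,a_i)$ is the current wealth level. The lower $\tau$-quantile of $\pi$, for $\tau\in(0,1]$, is $\underline q_\tau^\pi=\min\{w\in[-\infty,+\infty] : \mathbb P^\pi(W\le w)\ge\tau\}$, and its upper $\tau$-quantile, for $\tau\in[0,1)$, is $\overline q_\tau^\pi=\max\{w\in[-\infty,+\infty] : \mathbb P^\pi(W\ge w)\ge 1-\tau\}$. A policy is optimal for the lower (resp. upper) $\tau$-quantile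 criterion if its lower (resp. upper) $\tau$-quantile is the maximum over all policies. Proposition 3. For every $\tau\in(0,1]$ (resp. $\tau\in[0,1)$) there exists a policy that is optimal, among all policies, for the lower (resp. upper) $\tau$-quantile criterion and that is stationary deterministic wealth-Markovian, in each of the following two cases: (i) $r(s,a)\le 0$ for all $(s,a)\in\mathcal S\times\mathcal A$; (ii) $r(s,a)\ge 0$ for all $(s,a)\in\mathcal S\times\mathcal A$, and the optimal quantile $\sup_\pi\underline q_\tau^\pi$ (resp. $\sup_\pi\overline q_\tau^\pi$) has a finite upper bound. -/

import Mathlib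

open MeasureTheory ProbabilityTheory Filter Topology

noncomputable section

namespace QuantileMDP

/-- A Markov decision process with state set `S`, action set `A` (finite in the theorem),
transition probabilities `P s a s'`, numeric rewards `r s a` and an initial state. -/
structure MDP (S A : Type*) where
  P : S → A → PMF S
  r : S → A → ℝ
  s₀ : S

/-- An infinite-horizon policy, in full generality (history-dependent and randomized): the decision
rule of time `t` maps the past state-action pairs `(s₀, a₀), …, (sₜ₋₁, aₜ₋₁)` and the current state
`sₜ` to a probability distribution over actions. -/
def Policy (S A : Type*) : Type _ := (t : ℕ) → (Fin t → S × A) → S → PMF A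

namespace MDP

variable {S A : Type*} (M : MDP S A)

/-- The (undiscounted) wealth level of a finite history. -/
def wealth {t : ℕ} (h : Fin t → S × A) : ℝ := ∑ i, M.r (h i).1 (h i).2

/-- The policy uses one and the same decision rule `δ` at every time step, and `δ` selects a single
action as a function of the current state and the current wealth level. -/
def IsStationaryDeterministicWealthMarkovian (π : Policy S A) : Prop :=
  ∃ δ : S → ℝ → A, ∀ (t : ℕ) (h : Fin t → S × A) (s : S), π t h s = PMF.pure (δ s (M.wealth h))

/-- The wealth level of an infinite history: the limit in `[-∞, ∞]` of the wealth levels of its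
finite prefixes (written as a `limsup`; see `tendsto_totalWealth_of_nonneg` and
`tendsto_totalWealth_of_nonpos`). -/
def totalWealth (ω : ℕ → S × A) : EReal :=
  limsup (fun t : ℕ => ((M.wealth (fun i : Fin t => ω i) : ℝ) : EReal)) atTop

theorem wealth_prefix_succ (ω : ℕ → S × A) (t : ℕ) :
    M.wealth (fun i : Fin (t + 1) => ω i)
      = M.wealth (fun i : Fin t => ω i) + M.r (ω t).1 (ω t).2 := by
  simp [wealth, Fin.sum_univ_castSucc]

theorem tendsto_totalWealth_of_nonneg (hr : ∀ s a, 0 ≤ M.r s a) (ω : ℕ → S × A) :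
    Tendsto (fun t : ℕ => ((M.wealth (fun i : Fin t => ω i) : ℝ) : EReal)) atTop
      (𝓝 (M.totalWealth ω)) := by
  have hm : Monotone (fun t : ℕ => ((M.wealth (fun i : Fin t => ω i) : ℝ) : EReal)) := by
    refine monotone_nat_of_le_succ fun t => ?_
    rw [EReal.coe_le_coe_iff, wealth_prefix_succ]
    linarith [hr (ω t).1 (ω t).2]
  have h := tendsto_atTop_iSup hm
  rw [totalWealth, h.limsup_eq]
  exact h

theorem tendsto_totalWealth_of_nonpos (hr : ∀ s a, M.r s a ≤ 0) (ω : ℕ → S × A) :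
    Tendsto (fun t : ℕ => ((M.wealth (fun i : Fin t => ω i) : ℝ) : EReal)) atTop
      (𝓝 (M.totalWealth ω)) := by
  have hm : Antitone (fun t : ℕ => ((M.wealth (fun i : Fin t => ω i) : ℝ) : EReal)) := by
    refine antitone_nat_of_succ_le fun t => ?_
    rw [EReal.coe_le_coe_iff, wealth_prefix_succ]
    linarith [hr (ω t).1 (ω t).2]
  have h := tendsto_atTop_iInf hm
  rw [totalWealth, h.limsup_eq]
  exact h

/-- The law of `(s₀, a₀)`: the state is the initial one, the action is drawn by the policy. -/
def initStep (π : Policy S A) : PMF (S × A) :=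
  (π 0 Fin.elim0 M.s₀).map fun a => (M.s₀, a)

/-- The conditional law of `(sₜ₊₁, aₜ₊₁)` given `(s₀, a₀), …, (sₜ, aₜ)`: the next state is drawn
from `P sₜ aₜ`, then the next action is drawn by the policy. -/
def nextStep (π : Policy S A) (t : ℕ) (h : Finset.Iic t → S × A) : PMF (S × A) :=
  let last : S × A := h ⟨t, Finset.mem_Iic.2 le_rfl⟩
  (M.P last.1 last.2).bind fun s =>
    (π (t + 1) (fun i => h ⟨i, Finset.mem_Iic.2 (Nat.lt_succ_iff.1 i.2)⟩) s).map fun a => (s, a)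

variable [Finite S] [Finite A] [MeasurableSpace S] [DiscreteMeasurableSpace S]
  [MeasurableSpace A] [DiscreteMeasurableSpace A]

/-- `nextStep` as a Markov kernel. -/
def stepKernel (π : Policy S A) (t : ℕ) :
    Kernel ((i : Finset.Iic t) → (fun _ : ℕ => S × A) i) ((fun _ : ℕ => S × A) (t + 1)) where
  toFun h := (M.nextStep π t h).toMeasure
  measurable' := measurable_of_countable _

instance (π : Policy S A) (t : ℕ) : IsMarkovKernel (M.stepKernel π t) :=
  ⟨fun h => inferInstanceAs (IsProbabilityMeasure (M.nextStep π t h).toMeasure)⟩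

/-- The law of the infinite history `(s₀, a₀), (s₁, a₁), …` when the policy `π` is followed from the
initial state. -/
def law (π : Policy S A) : Measure (ℕ → S × A) :=
  Measure.bind ((M.initStep π).map fun x (_ : Finset.Iic 0) => x).toMeasure
    (Kernel.traj (X := fun _ : ℕ => S × A) (M.stepKernel π) 0)

instance (π : Policy S A) : IsProbabilityMeasure (M.law π) := by
  unfold law
  infer_instance

/-- The cumulative distribution `F^π(w)`. -/
def cumulative (π : Policy S A) (w : EReal) : ℝ :=
  (M.law π).real {ω | M.totalWealth ω ≤ w}

/-- The decumulative distribution `G^π(w)`. -/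
def decumulative (π : Policy S A) (w : EReal) : ℝ :=
  (M.law π).real {ω | w ≤ M.totalWealth ω}

/-- The lower `τ`-quantile of `π`, for `0 < τ ≤ 1`; the infimum is a minimum, see
`isLeast_lowerQuantile`. -/
def lowerQuantile (τ : ℝ) (π : Policy S A) : EReal :=
  sInf {w : EReal | τ ≤ M.cumulative π w}

/-- The upper `τ`-quantile of `π`, for `0 ≤ τ < 1`; the supremum is a maximum, see
`isGreatest_upperQuantile`. -/
def upperQuantile (τ : ℝ) (π : Policy S A) : EReal :=
  sSup {w : EReal | 1 - τ ≤ M.decumulative π w}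

/-- `π` is optimal for the lower `τ`-quantile criterion: its lower `τ`-quantile is the maximum over
all policies. -/
def IsLowerOptimal (τ : ℝ) (π : Policy S A) : Prop :=
  IsGreatest (Set.range (M.lowerQuantile τ)) (M.lowerQuantile τ π)

/-- `π` is optimal for the upper `τ`-quantile criterion: its upper `τ`-quantile is the maximum over
all policies. -/
def IsUpperOptimal (τ : ℝ) (π : Policy S A) : Prop :=
  IsGreatest (Set.range (M.upperQuantile τ)) (M.upperQuantile τ π)

theorem measurable_totalWealth : Measurable M.totalWealth := by
  unfold totalWealth
  refine Measurable.limsup fun t => ?_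
  refine measurable_coe_real_ereal.comp ?_
  have h1 : Measurable (M.wealth (t := t)) := measurable_of_countable _
  exact h1.comp (measurable_pi_lambda _ fun i => measurable_pi_apply _)

theorem isLeast_lowerQuantile {τ : ℝ} (hτ : τ ≤ 1) (π : Policy S A) :
    IsLeast {w : EReal | τ ≤ M.cumulative π w} (M.lowerQuantile τ π) := by
  refine ⟨?_, fun w hw => sInf_le hw⟩
  have hne : {w : EReal | τ ≤ M.cumulative π w}.Nonempty := ⟨⊤, by simpa [cumulative] using hτ⟩
  obtain ⟨u, hu, hlim, hmem⟩ := exists_seq_tendsto_sInf hne (OrderBot.bddBelow _)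
  have hset : {ω | M.totalWealth ω ≤ M.lowerQuantile τ π} = ⋂ n, {ω | M.totalWealth ω ≤ u n} := by
    ext ω
    simp only [Set.mem_ofPred_eq, Set.mem_iInter]
    exact ⟨fun h n => h.trans (sInf_le (hmem n)), fun h => ge_of_tendsto' hlim h⟩
  have ht : Tendsto (fun n => M.cumulative π (u n)) atTop
      (𝓝 (M.cumulative π (M.lowerQuantile τ π))) := by
    have := tendsto_measure_iInter_atTop (μ := M.law π)
      (s := fun n => {ω | M.totalWealth ω ≤ u n})
      (fun n => (M.measurable_totalWealth measurableSet_Iic).nullMeasurableSet)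
      (fun m n hmn ω hω => le_trans hω (hu hmn)) ⟨0, measure_ne_top _ _⟩
    rw [← hset] at this
    exact (ENNReal.tendsto_toReal (measure_ne_top _ _)).comp this
  exact ge_of_tendsto' ht hmem

theorem isGreatest_upperQuantile {τ : ℝ} (hτ : 0 ≤ τ) (π : Policy S A) :
    IsGreatest {w : EReal | 1 - τ ≤ M.decumulative π w} (M.upperQuantile τ π) := by
  refine ⟨?_, fun w hw => le_sSup hw⟩
  have hne : {w : EReal | 1 - τ ≤ M.decumulative π w}.Nonempty :=
    ⟨⊥, by simpa [decumulative] using hτ⟩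
  obtain ⟨u, hu, hlim, hmem⟩ := exists_seq_tendsto_sSup hne (OrderTop.bddAbove _)
  have hset : {ω | M.upperQuantile τ π ≤ M.totalWealth ω} = ⋂ n, {ω | u n ≤ M.totalWealth ω} := by
    ext ω
    simp only [Set.mem_ofPred_eq, Set.mem_iInter]
    exact ⟨fun h n => (le_sSup (hmem n)).trans h, fun h => le_of_tendsto' hlim h⟩
  have ht : Tendsto (fun n => M.decumulative π (u n)) atTop
      (𝓝 (M.decumulative π (M.upperQuantile τ π))) := by
    have := tendsto_measure_iInter_atTop (μ := M.law π)
      (s := fun n => {ω | u n ≤ M.totalWealth ω})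
      (fun n => (M.measurable_totalWealth measurableSet_Ici).nullMeasurableSet)
      (fun m n hmn ω hω => le_trans (hu hmn) hω) ⟨0, measure_ne_top _ _⟩
    rw [← hset] at this
    exact (ENNReal.tendsto_toReal (measure_ne_top _ _)).comp this
  exact ge_of_tendsto' ht hmem

end MDP

end QuantileMDP

end

/-!
Fix a level `q` and consider the problem of maximizing `P(W ≥ q)` over all policies. This problem
has an optimal policy that plays a fixed rule `δ s w` (`exists_rule_forall_law_le`), and the
quantile problem reduces to it: `W` takes values in a discrete set of finite wealth levels
together with `±∞` (`exists_lt_forall_totalWealth`), so for real `q` the lower (upper)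
`τ`-quantile of `π` is at least `q` iff `P(W ≥ q) > 1 - τ` (`≥ 1 - τ`), and the supremum `q` of
the quantiles, if it is real, is the quantile of some policy. A rule that is optimal for the level
`q` then has quantile at least `q`. If the supremum is `-∞`, every policy is optimal, and `+∞` is
excluded by the sign of the rewards in the first case and by assumption in the second.

Reaching a level is a control problem on the augmented states `(s, w)`. By backward induction,
`maxProb q n` bounds the probability that the wealth is at least `q` after `n` steps under any
policy (`law_real_wealth_le_maxProb`).

For nonpositive rewards, `W ≥ q` means that the wealth never drops below `q`. The functions
`maxProb q n` decrease to a limit `V`, and, since there are finitely many actions, in every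
augmented state some action `δ s w` does not decrease the expectation of `V`. Hence `δ` keeps the
wealth at or above `q` with probability at least `V`.

For nonnegative rewards, `W ≥ q` means that `q` is reached at some time. A rule that is greedy for
the undiscounted value can postpone the target forever, so a discount factor `β < 1` is
introduced. A greedy rule for the discounted problem attains at least the discounted value
(`discountedValue_le_law_real`). Only finitely many wealth levels below `q` are reachable, so
finitely many rules matter; the best of them dominates the discounted value for every `β`, and
`β → 1` gives the undiscounted bound.
-/

noncomputable section

namespace QuantileMDP

/-! ### Finite expectations -/

/-- The expectation of a real function on a finite type, as a finite sum. -/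
def expect {α : Type*} [Fintype α] (p : PMF α) (f : α → ℝ) : ℝ := ∑ a, (p a).toReal * f a

section Expect

variable {α β : Type*} [Fintype α] [Fintype β] (p : PMF α)

theorem integral_toMeasure_eq_expect [MeasurableSpace α] [MeasurableSingletonClass α] (f : α → ℝ) :
    ∫ a, f a ∂p.toMeasure = expect p f := by
  simp [expect, PMF.integral_eq_sum]

theorem sum_toReal_eq_one : ∑ a, (p a).toReal = 1 := by
  rw [← ENNReal.toReal_sum fun a _ => p.apply_ne_top a, ← tsum_fintype (L := .unconditional α),
    p.tsum_coe, ENNReal.toReal_one]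

theorem expect_const (c : ℝ) : expect p (fun _ => c) = c := by
  rw [expect, ← Finset.sum_mul, sum_toReal_eq_one, one_mul]

theorem expect_mono {f g : α → ℝ} (h : ∀ a, f a ≤ g a) : expect p f ≤ expect p g :=
  Finset.sum_le_sum fun a _ => mul_le_mul_of_nonneg_left (h a) ENNReal.toReal_nonneg

theorem expect_sub_const (f : α → ℝ) (c : ℝ) :
    expect p (fun a => f a - c) = expect p f - c := by
  conv_rhs => rw [← expect_const p c]
  simp [expect, mul_sub, Finset.sum_sub_distrib]

theorem expect_neg (f : α → ℝ) : expect p (fun a => -f a) = -expect p f := by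
  simp [expect]

theorem expect_pure (a : α) (f : α → ℝ) : expect (PMF.pure a) f = f a := by
  classical
  rw [expect, Finset.sum_eq_single a]
  · simp
  · intro b _ hb
    simp [PMF.pure_apply, hb]
  · simp

theorem expect_bind (q : α → PMF β) (f : β → ℝ) :
    expect (p.bind q) f = expect p (fun a => expect (q a) f) := by
  have h : ∀ b, ((p.bind q) b).toReal = ∑ a, (p a).toReal * (q a b).toReal := fun b => by
    rw [PMF.bind_apply, tsum_fintype,
      ENNReal.toReal_sum fun a _ => ENNReal.mul_ne_top (p.apply_ne_top a) ((q a).apply_ne_top b)]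
    simp
  simp only [expect, h, Finset.sum_mul, Finset.mul_sum]
  rw [Finset.sum_comm]
  simp only [mul_assoc]

theorem expect_map (g : α → β) (f : β → ℝ) :
    expect (p.map g) f = expect p (fun a => f (g a)) := by
  rw [← PMF.bind_pure_comp, expect_bind]
  simp [expect_pure]

theorem tendsto_expect {f : ℕ → α → ℝ} {g : α → ℝ}
    (h : ∀ a, Tendsto (fun n => f n a) atTop (𝓝 (g a))) :
    Tendsto (fun n => expect p (f n)) atTop (𝓝 (expect p g)) :=
  tendsto_finsetSum _ fun a _ => (h a).const_mul _

end Expect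

namespace MDP

variable {S A : Type*} [Fintype S] [Fintype A] [MeasurableSpace S] [DiscreteMeasurableSpace S]
  [MeasurableSpace A] [DiscreteMeasurableSpace A] (M : MDP S A) (π : Policy S A)

/-! ### The law of finite prefixes of the history -/

theorem law_eq_trajMeasure :
    M.law π = Kernel.trajMeasure (X := fun _ : ℕ => S × A) (M.initStep π).toMeasure
      (M.stepKernel π) := by
  rw [law, Kernel.trajMeasure, ← PMF.toMeasure_map _ _ (measurable_of_countable _)]
  rfl

/-- Conditioning on the history up to time `n`: the pair at time `n + 1` has law `nextStep`. -/
theorem integral_law_succ (n : ℕ) (f : (Finset.Iic n → S × A) → S × A → ℝ) :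
    ∫ ω, f (Preorder.frestrictLe (π := fun _ : ℕ => S × A) n ω) (ω (n + 1)) ∂M.law π
      = ∫ ω, expect (M.nextStep π n (Preorder.frestrictLe (π := fun _ : ℕ => S × A) n ω))
          (f (Preorder.frestrictLe (π := fun _ : ℕ => S × A) n ω)) ∂M.law π := by
  have hm := Kernel.map_frestrictLe_trajMeasure_compProd_eq_map_trajMeasure
    (X := fun _ : ℕ => S × A) (μ₀ := (M.initStep π).toMeasure) (κ := M.stepKernel π) (a := n)
  rw [← law_eq_trajMeasure] at hm
  have h1 : Measurable (Preorder.frestrictLe (π := fun _ : ℕ => S × A) n) :=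
    Preorder.measurable_frestrictLe n
  have h2 : Measurable (fun ω : ℕ → S × A =>
      (Preorder.frestrictLe (π := fun _ : ℕ => S × A) n ω, ω (n + 1))) :=
    h1.prodMk (measurable_pi_apply _)
  have : IsProbabilityMeasure ((M.law π).map (Preorder.frestrictLe (π := fun _ : ℕ => S × A) n)) :=
    Measure.isProbabilityMeasure_map h1.aemeasurable
  calc _ = ∫ y : (Finset.Iic n → S × A) × (S × A), f y.1 y.2 ∂((M.law π).map
          fun ω => (Preorder.frestrictLe (π := fun _ : ℕ => S × A) n ω, ω (n + 1))) := by
        rw [integral_map h2.aemeasurable (measurable_of_countable _).aestronglyMeasurable]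
    _ = ∫ h, ∫ x, f h x ∂(M.stepKernel π n h)
          ∂((M.law π).map (Preorder.frestrictLe (π := fun _ : ℕ => S × A) n)) := by
        rw [← hm, Measure.integral_compProd]
        exact Integrable.of_finite
    _ = ∫ ω, ∫ x, f (Preorder.frestrictLe (π := fun _ : ℕ => S × A) n ω) x
          ∂(M.stepKernel π n (Preorder.frestrictLe (π := fun _ : ℕ => S × A) n ω)) ∂M.law π := by
        rw [integral_map h1.aemeasurable (measurable_of_countable _).aestronglyMeasurable]
    _ = _ := by
        refine integral_congr_ae (Eventually.of_forall fun ω => ?_)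
        exact integral_toMeasure_eq_expect _ _

theorem integral_law_zero (f : S × A → ℝ) :
    ∫ ω, f (ω 0) ∂M.law π = expect (M.initStep π) f := by
  have h1 : Measurable (Preorder.frestrictLe (π := fun _ : ℕ => S × A) 0) :=
    Preorder.measurable_frestrictLe 0
  have hm : (M.law π).map (Preorder.frestrictLe (π := fun _ : ℕ => S × A) 0)
      = ((M.initStep π).map fun x (_ : Finset.Iic 0) => x).toMeasure := by
    rw [law, Measure.map_comp _ _ h1, Kernel.traj_map_frestrictLe, Kernel.partialTraj_self,
      Measure.id_comp]
  calc ∫ ω, f (ω 0) ∂M.law π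
      = ∫ h : Finset.Iic 0 → S × A, f (h ⟨0, by simp⟩)
          ∂((M.law π).map (Preorder.frestrictLe (π := fun _ : ℕ => S × A) 0)) := by
        rw [integral_map h1.aemeasurable (measurable_of_countable _).aestronglyMeasurable]
        rfl
    _ = expect (M.initStep π) f := by
        rw [hm, ← PMF.toMeasure_map _ _ (measurable_of_countable _),
          integral_map (measurable_of_countable _).aemeasurable
            (measurable_of_countable _).aestronglyMeasurable, integral_toMeasure_eq_expect]

/-- The expected value of `u` after playing `a` in state `s` at wealth level `w`. -/
def stepValue (u : S → ℝ → ℝ) (s : S) (a : A) (w : ℝ) : ℝ :=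
  expect (M.P s a) fun s' => u s' (w + M.r s a)

theorem integrable_prefix (n : ℕ) (g : (Finset.Iic n → S × A) → ℝ) :
    Integrable (fun ω => g (Preorder.frestrictLe (π := fun _ : ℕ => S × A) n ω)) (M.law π) := by
  have h1 : Measurable (Preorder.frestrictLe (π := fun _ : ℕ => S × A) n) :=
    Preorder.measurable_frestrictLe n
  have : IsProbabilityMeasure ((M.law π).map (Preorder.frestrictLe (π := fun _ : ℕ => S × A) n)) :=
    Measure.isProbabilityMeasure_map h1.aemeasurable
  have h : Integrable g ((M.law π).map (Preorder.frestrictLe (π := fun _ : ℕ => S × A) n)) :=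
    Integrable.of_finite
  exact h.comp_measurable h1

/-- The inequality of `integral_wealth_le`, integrated up to time `n`: with `(sₙ, aₙ)` already
drawn, the expected value of `u k` after the next transition is at most the value at the initial
state with `n + k + 1` steps to go. -/
theorem integral_stepValue_le {u : ℕ → S → ℝ → ℝ}
    (hu : ∀ (k t : ℕ) (h : Fin t → S × A) (s : S),
      expect (π t h s) (fun a => M.stepValue (u k) s a (M.wealth h)) ≤ u (k + 1) s (M.wealth h))
    (n k : ℕ) :
    ∫ ω, M.stepValue (u k) (ω n).1 (ω n).2 (M.wealth fun i : Fin n => ω i) ∂M.law π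
      ≤ u (n + k + 1) M.s₀ 0 := by
  induction n generalizing k with
  | zero =>
    have h0 : ∀ h : Fin 0 → S × A, M.wealth h = 0 := fun h => by simp [wealth]
    have := hu k 0 Fin.elim0 M.s₀
    simp only [h0, Nat.zero_add] at this ⊢
    rw [M.integral_law_zero π fun x => M.stepValue (u k) x.1 x.2 0, initStep, expect_map]
    exact this
  | succ n ih =>
    let f : (Finset.Iic n → S × A) → S × A → ℝ := fun h x =>
      M.stepValue (u k) x.1 x.2 (M.wealth fun i : Fin (n + 1) =>
        h ⟨i, Finset.mem_Iic.2 (Nat.lt_succ_iff.1 i.2)⟩)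
    rw [show n + 1 + k = n + (k + 1) by omega]
    -- condition on the first `n + 1` pairs, then average over the state and action at time `n + 1`
    refine (M.integral_law_succ π n f).le.trans (le_trans ?_ (ih (k + 1)))
    refine integral_mono (M.integrable_prefix π n fun h => expect (M.nextStep π n h) (f h))
      (M.integrable_prefix π n fun h => M.stepValue (u (k + 1)) (h ⟨n, by simp⟩).1
        (h ⟨n, by simp⟩).2 (M.wealth fun i : Fin n => h ⟨i, by simp⟩)) fun ω => ?_
    simp only [f, nextStep, expect_bind, expect_map, stepValue]
    refine expect_mono _ fun s => ?_
    have := hu k (n + 1) (fun i => ω i) s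
    rw [wealth_prefix_succ] at this
    simpa only [stepValue, wealth_prefix_succ, Preorder.frestrictLe_apply] using this

/-- A family `u` that dominates one step of `π` bounds the expected terminal payoff: `u k s w`
bounds the payoff obtained with `k` steps to go from state `s` and wealth `w`. -/
theorem integral_wealth_le {u : ℕ → S → ℝ → ℝ} {g : ℝ → ℝ} (h0 : ∀ s w, g w ≤ u 0 s w)
    (hu : ∀ (k t : ℕ) (h : Fin t → S × A) (s : S),
      expect (π t h s) (fun a => M.stepValue (u k) s a (M.wealth h)) ≤ u (k + 1) s (M.wealth h))
    (n : ℕ) :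
    ∫ ω, g (M.wealth fun i : Fin n => ω i) ∂M.law π ≤ u n M.s₀ 0 := by
  cases n with
  | zero => simpa [wealth] using h0 M.s₀ 0
  | succ n =>
    refine le_trans ?_ (M.integral_stepValue_le π hu n 0)
    refine integral_mono (M.integrable_prefix π n fun h => g (M.wealth fun i : Fin (n + 1) =>
        h ⟨i, Finset.mem_Iic.2 (Nat.lt_succ_iff.1 i.2)⟩))
      (M.integrable_prefix π n fun h => M.stepValue (u 0) (h ⟨n, by simp⟩).1
        (h ⟨n, by simp⟩).2 (M.wealth fun i : Fin n => h ⟨i, by simp⟩)) fun ω => ?_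
    simp only [stepValue]
    rw [wealth_prefix_succ, ← expect_const (M.P (ω n).1 (ω n).2) (g _)]
    exact expect_mono _ fun s => h0 _ _

end MDP

namespace MDP

variable {S A : Type*} (M : MDP S A)

/-! ### Wealth levels form a discrete set -/

/-- The wealth levels of absolute value at most `K` that finite histories can reach. -/
def wealthLevels (K : ℝ) : Set ℝ :=
  {x | |x| ≤ K ∧ ∃ (t : ℕ) (h : Fin t → S × A), M.wealth h = x}

theorem sum_abs_eq_abs_wealth (hr : (∀ s a, 0 ≤ M.r s a) ∨ ∀ s a, M.r s a ≤ 0) {t : ℕ}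
    (h : Fin t → S × A) : ∑ i, |M.r (h i).1 (h i).2| = |M.wealth h| := by
  rcases hr with hr | hr
  · rw [wealth, abs_of_nonneg (Finset.sum_nonneg fun i _ => hr _ _)]
    exact Finset.sum_congr rfl fun i _ => abs_of_nonneg (hr _ _)
  · rw [wealth, abs_of_nonpos (Finset.sum_nonpos fun i _ => hr _ _), ← Finset.sum_neg_distrib]
    exact Finset.sum_congr rfl fun i _ => abs_of_nonpos (hr _ _)

/-- A wealth level is determined by the number of occurrences of each pair with nonzero reward, and
these numbers are bounded when the wealth is. -/
theorem finite_wealthLevels [Finite S] [Finite A]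
    (hr : (∀ s a, 0 ≤ M.r s a) ∨ ∀ s a, M.r s a ≤ 0) (K : ℝ) :
    (M.wealthLevels K).Finite := by
  classical
  cases nonempty_fintype S
  cases nonempty_fintype A
  -- `b x` bounds the number of occurrences of `x`; it is `0` by convention when the reward is `0`
  let R : S × A → ℝ := fun x => M.r x.1 x.2
  let b : S × A → ℕ := fun x => ⌊K / |R x|⌋₊
  refine ((Set.Finite.pi' fun x : S × A => Set.finite_Iic (b x)).image
    fun m : S × A → ℕ => ∑ x, m x * R x).subset ?_
  rintro _ ⟨hK, t, h, rfl⟩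
  let c : S × A → ℕ := fun x => (Finset.univ.filter fun i => h i = x).card
  have hsum : ∀ f : S × A → ℝ, ∑ i, f (h i) = ∑ x, (c x : ℝ) * f x := fun f => by
    rw [← Finset.sum_fiberwise Finset.univ h fun i => f (h i)]
    refine Finset.sum_congr rfl fun x _ => ?_
    rw [Finset.sum_congr rfl (g := fun _ => f x) fun i hi => by rw [(Finset.mem_filter.1 hi).2]]
    simp [c]
  refine ⟨fun x => if R x = 0 then 0 else c x, fun x => ?_, ?_⟩
  · by_cases hx : R x = 0
    · simp [hx]
    · simp only [hx, if_false, Set.mem_Iic]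
      refine Nat.le_floor ((le_div_iff₀ (abs_pos.2 hx)).2 (le_trans ?_ hK))
      rw [← M.sum_abs_eq_abs_wealth hr, hsum fun x => |R x|]
      exact Finset.single_le_sum (f := fun x => (c x : ℝ) * |R x|)
        (fun y _ => by positivity) (Finset.mem_univ x)
  · rw [wealth, hsum R]
    refine Finset.sum_congr rfl fun x _ => ?_
    by_cases hx : R x = 0 <;> simp [hx]

theorem tendsto_totalWealth (hr : (∀ s a, 0 ≤ M.r s a) ∨ ∀ s a, M.r s a ≤ 0) (ω : ℕ → S × A) :
    Tendsto (fun t : ℕ => ((M.wealth (fun i : Fin t => ω i) : ℝ) : EReal)) atTop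
      (𝓝 (M.totalWealth ω)) :=
  hr.elim (fun h => M.tendsto_totalWealth_of_nonneg h ω)
    fun h => M.tendsto_totalWealth_of_nonpos h ω

/-- A finite total wealth is attained after finitely many steps. -/
theorem exists_wealth_eq_of_totalWealth_eq [Finite S] [Finite A]
    (hr : (∀ s a, 0 ≤ M.r s a) ∨ ∀ s a, M.r s a ≤ 0)
    {ω : ℕ → S × A} {x : ℝ} (hx : M.totalWealth ω = x) :
    ∃ n, M.wealth (fun i : Fin n => ω i) = x := by
  have ht := M.tendsto_totalWealth hr ω
  rw [hx, EReal.tendsto_coe] at ht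
  have hfin : {y | ∃ n, M.wealth (fun i : Fin n => ω i) = y ∧ |y| ≤ |x| + 1}.Finite :=
    (M.finite_wealthLevels hr (|x| + 1)).subset fun y ⟨n, h1, h2⟩ => ⟨h2, n, _, h1⟩
  obtain ⟨n, hn, -⟩ := hfin.isClosed.mem_of_tendsto ht <| by
    filter_upwards [ht.abs.eventually_le_const (lt_add_one |x|)] with n hn
    exact ⟨n, rfl, hn⟩
  exact ⟨n, hn⟩

/-- The total wealth avoids a left neighbourhood of every real number. -/
theorem exists_lt_forall_totalWealth [Finite S] [Finite A]
    (hr : (∀ s a, 0 ≤ M.r s a) ∨ ∀ s a, M.r s a ≤ 0) (q : ℝ) :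
    ∃ q' < q, ∀ ω : ℕ → S × A, (q' : EReal) < M.totalWealth ω → (q : EReal) ≤ M.totalWealth ω := by
  have h1 : ∀ᶠ q' in 𝓝[<] q, ∀ y ∈ M.wealthLevels (|q| + 1), y < q → y < q' := by
    refine (eventually_all_finite (M.finite_wealthLevels hr _)).2 fun y _ => ?_
    by_cases hy : y < q
    · filter_upwards [eventually_nhdsWithin_of_eventually_nhds (eventually_gt_nhds hy)] with q' h _
      exact h
    · exact Eventually.of_forall fun _ h => absurd h hy
  obtain ⟨q', h1, h2, h3⟩ := (h1.and ((eventually_nhdsWithin_of_eventually_nhds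
    (eventually_gt_nhds (sub_one_lt q))).and self_mem_nhdsWithin)).exists
  refine ⟨q', h3, fun ω hω => ?_⟩
  by_contra! hlt
  have hreal : ((M.totalWealth ω).toReal : EReal) = M.totalWealth ω :=
    EReal.coe_toReal hlt.ne_top (ne_bot_of_gt hω)
  set x := (M.totalWealth ω).toReal
  rw [← hreal, EReal.coe_lt_coe_iff] at hlt hω
  obtain ⟨n, hn⟩ := M.exists_wealth_eq_of_totalWealth_eq hr hreal.symm
  refine (h1 x ⟨?_, n, _, hn⟩ hlt).not_gt hω
  rw [abs_le]
  constructor <;> linarith [neg_abs_le q, le_abs_self q, abs_nonneg q]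

theorem le_totalWealth_iff_of_nonpos (hr : ∀ s a, M.r s a ≤ 0) (ω : ℕ → S × A) (q : ℝ) :
    (q : EReal) ≤ M.totalWealth ω ↔ ∀ n, q ≤ M.wealth (fun i : Fin n => ω i) := by
  have ht := M.tendsto_totalWealth_of_nonpos hr ω
  have hanti : Antitone (fun t : ℕ => ((M.wealth (fun i : Fin t => ω i) : ℝ) : EReal)) := by
    refine antitone_nat_of_succ_le fun t => ?_
    rw [EReal.coe_le_coe_iff, wealth_prefix_succ]
    linarith [hr (ω t).1 (ω t).2]
  refine ⟨fun h n => EReal.coe_le_coe_iff.1 (h.trans (hanti.le_of_tendsto ht n)), fun h => ?_⟩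
  exact ge_of_tendsto' ht fun n => EReal.coe_le_coe_iff.2 (h n)

theorem totalWealth_nonpos (hr : ∀ s a, M.r s a ≤ 0) (ω : ℕ → S × A) : M.totalWealth ω ≤ 0 :=
  le_of_tendsto' (M.tendsto_totalWealth_of_nonpos hr ω) fun _ =>
    EReal.coe_nonpos.2 (Finset.sum_nonpos fun _ _ => hr _ _)

theorem monotone_wealth_of_nonneg (hr : ∀ s a, 0 ≤ M.r s a) (ω : ℕ → S × A) :
    Monotone (fun t : ℕ => M.wealth (fun i : Fin t => ω i)) := by
  refine monotone_nat_of_le_succ fun t => ?_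
  rw [wealth_prefix_succ]
  linarith [hr (ω t).1 (ω t).2]

/-- Discreteness is needed when `W = q`: the level is then attained, not just approached. -/
theorem le_totalWealth_iff_of_nonneg [Finite S] [Finite A]
    (hr : ∀ s a, 0 ≤ M.r s a) (ω : ℕ → S × A) (q : ℝ) :
    (q : EReal) ≤ M.totalWealth ω ↔ ∃ n, q ≤ M.wealth (fun i : Fin n => ω i) := by
  have ht := M.tendsto_totalWealth_of_nonneg hr ω
  constructor
  · intro h
    obtain h | h := h.eq_or_lt
    · obtain ⟨n, hn⟩ := M.exists_wealth_eq_of_totalWealth_eq (.inl hr) h.symm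
      exact ⟨n, hn.ge⟩
    · obtain ⟨n, hn⟩ := (ht.eventually_const_lt h).exists
      exact ⟨n, (EReal.coe_lt_coe_iff.1 hn).le⟩
  · rintro ⟨n, hn⟩
    refine (EReal.coe_le_coe_iff.2 hn).trans (Monotone.ge_of_tendsto (fun i j hij => ?_) ht n)
    exact EReal.coe_le_coe_iff.2 (M.monotone_wealth_of_nonneg hr ω hij)

end MDP

namespace MDP

/-! ### One-step operators -/

section OneStep

variable {S A : Type*} [Fintype S] (M : MDP S A)

theorem stepValue_mono {u v : S → ℝ → ℝ} (h : ∀ s w, u s w ≤ v s w) (s : S) (a : A) (w : ℝ) :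
    M.stepValue u s a w ≤ M.stepValue v s a w :=
  expect_mono _ fun _ => h _ _

theorem stepValue_const (c : ℝ) (s : S) (a : A) (w : ℝ) :
    M.stepValue (fun _ _ => c) s a w = c :=
  expect_const _ c

theorem stepValue_smul (c : ℝ) (u : S → ℝ → ℝ) (s : S) (a : A) (w : ℝ) :
    M.stepValue (fun s w => c * u s w) s a w = c * M.stepValue u s a w := by
  simp only [stepValue, expect, Finset.mul_sum]
  exact Finset.sum_congr rfl fun _ _ => by ring

/-- The optimal expected value of `u` after one step from state `s` at wealth level `w`. -/
def bestValue (u : S → ℝ → ℝ) (s : S) (w : ℝ) : ℝ := ⨆ a, M.stepValue u s a w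

theorem bestValue_le [Nonempty A] {u : S → ℝ → ℝ} {s : S} {w c : ℝ}
    (h : ∀ a, M.stepValue u s a w ≤ c) :
    M.bestValue u s w ≤ c :=
  ciSup_le h

theorem bestValue_const [Nonempty A] (c : ℝ) (s : S) (w : ℝ) :
    M.bestValue (fun _ _ => c) s w = c := by
  simp [bestValue, stepValue_const]

theorem bestValue_smul {c : ℝ} (hc : 0 ≤ c) (u : S → ℝ → ℝ) (s : S) (w : ℝ) :
    M.bestValue (fun s w => c * u s w) s w = c * M.bestValue u s w := by
  simp [bestValue, stepValue_smul, Real.mul_iSup_of_nonneg hc]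

variable [Finite A]

theorem stepValue_le_bestValue (u : S → ℝ → ℝ) (s : S) (a : A) (w : ℝ) :
    M.stepValue u s a w ≤ M.bestValue u s w :=
  le_ciSup (f := fun a => M.stepValue u s a w) (Set.finite_range _).bddAbove a

variable [Nonempty A]

theorem exists_stepValue_eq_bestValue (u : S → ℝ → ℝ) (s : S) (w : ℝ) :
    ∃ a, M.stepValue u s a w = M.bestValue u s w :=
  exists_eq_ciSup_of_finite

theorem bestValue_mono {u v : S → ℝ → ℝ} (h : ∀ s w, u s w ≤ v s w) (s : S) (w : ℝ) :
    M.bestValue u s w ≤ M.bestValue v s w :=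
  M.bestValue_le fun a => (M.stepValue_mono h s a w).trans (M.stepValue_le_bestValue v s a w)

/-- The maximal probability, over all policies, that the wealth is at least `q` after `n` more
steps from state `s` at wealth level `w`, by backward induction. -/
def maxProb (q : ℝ) : ℕ → S → ℝ → ℝ
  | 0, _, w => if q ≤ w then 1 else 0
  | n + 1, s, w => M.bestValue (maxProb q n) s w

theorem maxProb_nonneg (q : ℝ) (n : ℕ) (s : S) (w : ℝ) : 0 ≤ M.maxProb q n s w := by
  induction n generalizing s w with
  | zero => rw [maxProb]; split_ifs <;> norm_num
  | succ n ih => exact (M.bestValue_const 0 s w).ge.trans (M.bestValue_mono ih s w)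

theorem maxProb_le_one (q : ℝ) (n : ℕ) (s : S) (w : ℝ) : M.maxProb q n s w ≤ 1 := by
  induction n generalizing s w with
  | zero => rw [maxProb]; split_ifs <;> norm_num
  | succ n ih => exact (M.bestValue_mono ih s w).trans (M.bestValue_const 1 s w).le

theorem maxProb_succ_le_of_nonpos (hr : ∀ s a, M.r s a ≤ 0) (q : ℝ) (n : ℕ) (s : S) (w : ℝ) :
    M.maxProb q (n + 1) s w ≤ M.maxProb q n s w := by
  induction n generalizing s w with
  | zero =>
    by_cases hw : q ≤ w
    · simpa [maxProb, hw] using M.maxProb_le_one q 1 s w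
    · refine M.bestValue_le fun a => ?_
      rw [← M.stepValue_const (M.maxProb q 0 s w) s a w]
      refine expect_mono _ fun s' => ?_
      have : ¬ q ≤ w + M.r s a := fun h => hw (by linarith [hr s a])
      simp [maxProb, hw, this]
  | succ n ih => exact M.bestValue_mono ih s w

/-- Value iteration for the `β`-discounted problem of reaching wealth `q`: the payoff is `β ^ k` if
the target is first reached after `k < n` steps, and `0` otherwise. -/
def discountedProb (β q : ℝ) : ℕ → S → ℝ → ℝ
  | 0, _, _ => 0
  | n + 1, s, w => if q ≤ w then 1 else β * M.bestValue (discountedProb β q n) s w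

variable {β : ℝ} (q : ℝ)

theorem discountedProb_nonneg (h0 : 0 ≤ β) (n : ℕ) (s : S) (w : ℝ) :
    0 ≤ M.discountedProb β q n s w := by
  induction n generalizing s w with
  | zero => exact le_rfl
  | succ n ih =>
    rw [discountedProb]
    split_ifs
    · exact zero_le_one
    · exact mul_nonneg h0 ((M.bestValue_const 0 s w).ge.trans (M.bestValue_mono ih s w))

theorem discountedProb_le_one (h0 : 0 ≤ β) (h1 : β ≤ 1) (n : ℕ) (s : S) (w : ℝ) :
    M.discountedProb β q n s w ≤ 1 := by
  induction n generalizing s w with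
  | zero => exact zero_le_one
  | succ n ih =>
    rw [discountedProb]
    split_ifs
    · exact le_rfl
    · exact (mul_le_of_le_one_left
        ((M.bestValue_const 0 s w).ge.trans (M.bestValue_mono (M.discountedProb_nonneg q h0 n) s w))
        h1).trans ((M.bestValue_mono ih s w).trans (M.bestValue_const 1 s w).le)

theorem pow_mul_maxProb_le_discountedProb (h0 : 0 ≤ β) (h1 : β ≤ 1) (n : ℕ) (s : S) (w : ℝ) :
    β ^ n * M.maxProb q n s w ≤ M.discountedProb β q (n + 1) s w := by
  induction n generalizing s w with
  | zero =>
    have hn := M.discountedProb_nonneg q h0 1 s w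
    by_cases hw : q ≤ w
    · simp [maxProb, discountedProb, hw]
    · simpa [maxProb, hw] using hn
  | succ n ih =>
    rw [discountedProb]
    split_ifs with hw
    · exact mul_le_one₀ (pow_le_one₀ h0 h1) (M.maxProb_nonneg q _ s w) (M.maxProb_le_one q _ s w)
    · rw [maxProb, pow_succ', mul_assoc, ← M.bestValue_smul (pow_nonneg h0 n)]
      exact mul_le_mul_of_nonneg_left (M.bestValue_mono ih s w) h0

/-- The value of the `β`-discounted problem of reaching wealth `q`. -/
def discountedValue (β q : ℝ) (s : S) (w : ℝ) : ℝ := ⨆ n, M.discountedProb β q n s w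

theorem discountedProb_le_discountedValue (h0 : 0 ≤ β) (h1 : β ≤ 1) (n : ℕ) (s : S) (w : ℝ) :
    M.discountedProb β q n s w ≤ M.discountedValue β q s w :=
  le_ciSup (f := fun n => M.discountedProb β q n s w)
    ⟨1, Set.forall_mem_range.2 fun n => M.discountedProb_le_one q h0 h1 n s w⟩ n

theorem discountedValue_le_one (h0 : 0 ≤ β) (h1 : β ≤ 1) (s : S) (w : ℝ) :
    M.discountedValue β q s w ≤ 1 :=
  ciSup_le fun n => M.discountedProb_le_one q h0 h1 n s w

theorem discountedValue_le_bestValue (h0 : 0 ≤ β) (h1 : β ≤ 1) (s : S) {w : ℝ} (hw : w < q) :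
    M.discountedValue β q s w ≤ β * M.bestValue (M.discountedValue β q) s w := by
  have hle := M.discountedProb_le_discountedValue q h0 h1
  refine ciSup_le fun n => ?_
  cases n with
  | zero =>
    refine mul_nonneg h0 ((M.bestValue_const 0 s w).ge.trans (M.bestValue_mono (fun s w => ?_) s w))
    exact hle 0 s w
  | succ n =>
    rw [discountedProb, if_neg hw.not_ge]
    exact mul_le_mul_of_nonneg_left (M.bestValue_mono (hle n) s w) h0

end OneStep

variable {S A : Type*} [Fintype S] [Fintype A] [MeasurableSpace S] [DiscreteMeasurableSpace S]
  [MeasurableSpace A] [DiscreteMeasurableSpace A] (M : MDP S A)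

/-! ### Probabilities of finite-horizon events -/

/-- The stationary deterministic wealth-Markovian policy with decision rule `δ`. -/
def rulePolicy {S A : Type*} (M : MDP S A) (δ : S → ℝ → A) : Policy S A :=
  fun _ h s => PMF.pure (δ s (M.wealth h))

theorem measurable_wealth_prefix (n : ℕ) :
    Measurable fun ω : ℕ → S × A => M.wealth fun i : Fin n => ω i :=
  (measurable_of_countable (M.wealth (t := n))).comp
    (measurable_pi_lambda _ fun _ => measurable_pi_apply _)

theorem integral_indicator_wealth (π : Policy S A) (q : ℝ) (n : ℕ) :
    ∫ ω, (if q ≤ M.wealth fun i : Fin n => ω i then 1 else 0) ∂M.law π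
      = (M.law π).real {ω | q ≤ M.wealth fun i : Fin n => ω i} := by
  rw [← integral_indicator_one (measurableSet_le measurable_const (M.measurable_wealth_prefix n))]
  rfl

theorem law_real_wealth_le_maxProb [Nonempty A] (π : Policy S A) (q : ℝ) (n : ℕ) :
    (M.law π).real {ω | q ≤ M.wealth fun i : Fin n => ω i} ≤ M.maxProb q n M.s₀ 0 := by
  rw [← integral_indicator_wealth]
  refine M.integral_wealth_le π (g := fun w => if q ≤ w then 1 else 0) (fun s w => le_rfl)
    (fun k t h s => ?_) n
  rw [← expect_const (π t h s) (M.maxProb q (k + 1) s (M.wealth h))]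
  exact expect_mono _ fun a => M.stepValue_le_bestValue _ s a _

/-- A family `v` that one step of the decision rule `δ` improves is a lower bound for the
probabilities under `δ`. The step inequality is only needed at reachable wealth levels. -/
theorem le_law_real_wealth (δ : S → ℝ → A) (q : ℝ) {v : ℕ → S → ℝ → ℝ}
    (h0 : ∀ s w, v 0 s w ≤ if q ≤ w then 1 else 0)
    (hv : ∀ (k t : ℕ) (h : Fin t → S × A) (s : S),
      v (k + 1) s (M.wealth h) ≤ M.stepValue (v k) s (δ s (M.wealth h)) (M.wealth h)) (n : ℕ) :
    v n M.s₀ 0 ≤ (M.law (M.rulePolicy δ)).real {ω | q ≤ M.wealth fun i : Fin n => ω i} := by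
  have := M.integral_wealth_le (M.rulePolicy δ) (g := fun w => -(if q ≤ w then 1 else 0))
    (u := fun k s w => -v k s w) (fun s w => neg_le_neg (h0 s w)) (fun k t h s => by
      simp only [rulePolicy, expect_pure, stepValue, expect_neg]
      exact neg_le_neg (hv k t h s)) n
  rw [integral_neg, integral_indicator_wealth] at this
  exact neg_le_neg_iff.1 this

/-! ### Optimal rules for reaching a wealth level -/

/-- For nonpositive rewards the limit of `maxProb q n` is a value function with a greedy rule. -/
theorem exists_rule_forall_law_le_of_nonpos [Nonempty A] (hr : ∀ s a, M.r s a ≤ 0) (q : ℝ) :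
    ∃ δ : S → ℝ → A, ∀ π : Policy S A, (M.law π).real {ω | (q : EReal) ≤ M.totalWealth ω}
      ≤ (M.law (M.rulePolicy δ)).real {ω | (q : EReal) ≤ M.totalWealth ω} := by
  set V : S → ℝ → ℝ := fun s w => ⨅ n, M.maxProb q n s w with hV
  have hanti : ∀ s w, Antitone fun n => M.maxProb q n s w := fun s w =>
    antitone_nat_of_succ_le fun n => M.maxProb_succ_le_of_nonpos hr q n s w
  have hbdd : ∀ s w, BddBelow (Set.range fun n => M.maxProb q n s w) := fun s w =>
    ⟨0, Set.forall_mem_range.2 fun n => M.maxProb_nonneg q n s w⟩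
  have hlim : ∀ s w, Tendsto (fun n => M.maxProb q n s w) atTop (𝓝 (V s w)) := fun s w =>
    tendsto_atTop_ciInf (hanti s w) (hbdd s w)
  have hVle : ∀ n s w, V s w ≤ M.maxProb q n s w := fun n s w => ciInf_le (hbdd s w) n
  have hgreedy : ∀ s w, ∃ a, V s w ≤ M.stepValue V s a w := by
    intro s w
    by_contra! hcon
    -- if every action falls short of `V`, finitely many strict limits fail together at some `n`
    have hev : ∀ᶠ n in atTop, ∀ a, M.stepValue (M.maxProb q n) s a w < V s w :=
      eventually_all.2 fun a =>
        (tendsto_expect (M.P s a) fun s' => hlim s' (w + M.r s a)).eventually_lt_const (hcon a)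
    obtain ⟨n, hn⟩ := hev.exists
    obtain ⟨a, ha⟩ := M.exists_stepValue_eq_bestValue (M.maxProb q n) s w
    exact (hn a).not_ge (ha ▸ hVle (n + 1) s w)
  choose δ hδ using hgreedy
  have hset : {ω : ℕ → S × A | (q : EReal) ≤ M.totalWealth ω}
      = ⋂ n, {ω | q ≤ M.wealth fun i : Fin n => ω i} := by
    ext ω
    simp [M.le_totalWealth_iff_of_nonpos hr]
  refine ⟨δ, fun π => le_trans (b := V M.s₀ 0) ?_ ?_⟩
  · refine le_ciInf fun n => le_trans ?_ (M.law_real_wealth_le_maxProb π q n)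
    rw [hset]
    exact measureReal_mono (Set.iInter_subset _ n)
  · have hmono : Antitone fun n => {ω : ℕ → S × A | q ≤ M.wealth fun i : Fin n => ω i} :=
      antitone_nat_of_succ_le fun n ω (hω : q ≤ _) => by
        rw [wealth_prefix_succ] at hω
        exact hω.trans (by linarith [hr (ω n).1 (ω n).2])
    have ht := tendsto_measure_iInter_atTop (μ := M.law (M.rulePolicy δ))
      (fun n => (measurableSet_le measurable_const
        (M.measurable_wealth_prefix n) : MeasurableSet {ω | q ≤ _}).nullMeasurableSet) hmono
      ⟨0, measure_ne_top _ _⟩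
    rw [← hset] at ht
    exact ge_of_tendsto' ((ENNReal.tendsto_toReal (measure_ne_top _ _)).comp ht) fun n =>
      M.le_law_real_wealth δ q (v := fun _ => V) (hVle 0) (fun _ _ h s => hδ s _) n

/-- A rule that is greedy for the discounted problem does at least as well without discounting. -/
theorem discountedValue_le_law_real (hr : ∀ s a, 0 ≤ M.r s a) [Nonempty A] {β q : ℝ} (h0 : 0 ≤ β)
    (h1 : β < 1) {δ : S → ℝ → A}
    (hδ : ∀ (t : ℕ) (h : Fin t → S × A) (s : S), M.wealth h < q →
      M.discountedValue β q s (M.wealth h) ≤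
        β * M.stepValue (M.discountedValue β q) s (δ s (M.wealth h)) (M.wealth h)) :
    M.discountedValue β q M.s₀ 0
      ≤ (M.law (M.rulePolicy δ)).real {ω | (q : EReal) ≤ M.totalWealth ω} := by
  set V := M.discountedValue β q
  have hV1 := M.discountedValue_le_one q h0 h1.le
  -- with `n` steps to go, cutting off the discounted problem loses at most `β ^ n`
  let v : ℕ → S → ℝ → ℝ := fun n s w => if q ≤ w then 1 else max (V s w - β ^ n) 0
  have hVv : ∀ n s w, V s w - β ^ n ≤ v n s w := fun n s w => by
    simp only [v]
    split_ifs
    · linarith [hV1 s w, pow_nonneg h0 n]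
    · exact le_max_left _ _
  have hv0 : ∀ n s w, 0 ≤ v n s w := fun n s w => by
    simp only [v]
    split_ifs
    · exact zero_le_one
    · exact le_max_right _ _
  have hstep0 : ∀ n s a w, 0 ≤ M.stepValue (v n) s a w := fun n s a w =>
    (M.stepValue_const 0 s a w).ge.trans (M.stepValue_mono (hv0 n) s a w)
  have hle : ∀ n, V M.s₀ 0 - β ^ n
      ≤ (M.law (M.rulePolicy δ)).real {ω | (q : EReal) ≤ M.totalWealth ω} := fun n => by
    refine (hVv n _ _).trans ((M.le_law_real_wealth δ q (v := v) ?_ ?_ n).trans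
      (measureReal_mono fun ω hω => (M.le_totalWealth_iff_of_nonneg hr ω q).2 ⟨n, hω⟩))
    · intro s w
      simp only [v]
      split_ifs
      · exact le_rfl
      · simpa using hV1 s w
    · intro k t h s
      by_cases hw : q ≤ M.wealth h
      · refine ((if_pos hw).le.trans (expect_const (M.P s (δ s (M.wealth h))) 1).ge).trans
          (expect_mono _ fun s' => ?_)
        exact (if_pos (hw.trans (by linarith [hr s (δ s (M.wealth h))]))).ge
      · refine (if_neg hw).le.trans (max_le ?_ (hstep0 _ _ _ _))
        have h2 : M.stepValue V s (δ s (M.wealth h)) (M.wealth h) - β ^ k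
            ≤ M.stepValue (v k) s (δ s (M.wealth h)) (M.wealth h) := by
          rw [stepValue, ← expect_sub_const]
          exact expect_mono _ fun s' => hVv k _ _
        calc V s (M.wealth h) - β ^ (k + 1)
            ≤ β * (M.stepValue V s (δ s (M.wealth h)) (M.wealth h) - β ^ k) := by
              rw [pow_succ', mul_sub]
              exact sub_le_sub_right (hδ t h s (not_le.1 hw)) _
          _ ≤ β * M.stepValue (v k) s (δ s (M.wealth h)) (M.wealth h) :=
              mul_le_mul_of_nonneg_left h2 h0
          _ ≤ _ := mul_le_of_le_one_left (hstep0 _ _ _ _) h1.le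
  have hlim : Tendsto (fun n => V M.s₀ 0 - β ^ n) atTop (𝓝 (V M.s₀ 0 - 0)) :=
    (tendsto_pow_atTop_nhds_zero_of_lt_one h0 h1).const_sub _
  rw [sub_zero] at hlim
  exact le_of_tendsto' hlim hle

/-- For nonnegative rewards the best of the finitely many rules on the reachable levels below `q`
dominates every discounted value. -/
theorem exists_rule_forall_law_le_of_nonneg [Nonempty A] (hr : ∀ s a, 0 ≤ M.r s a) (q : ℝ) :
    ∃ δ : S → ℝ → A, ∀ π : Policy S A, (M.law π).real {ω | (q : EReal) ≤ M.totalWealth ω}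
      ≤ (M.law (M.rulePolicy δ)).real {ω | (q : EReal) ≤ M.totalWealth ω} := by
  classical
  have : Finite (M.wealthLevels |q|) := M.finite_wealthLevels (.inl hr) _
  let a₀ : A := Classical.arbitrary A
  -- the action chosen at other levels is irrelevant: they are unreachable or at least `q`
  let ext : (S × M.wealthLevels |q| → A) → S → ℝ → A := fun g s w =>
    if h : w ∈ M.wealthLevels |q| then g (s, ⟨w, h⟩) else a₀
  obtain ⟨g, hg⟩ := Finite.exists_max fun g : S × M.wealthLevels |q| → A =>
    (M.law (M.rulePolicy (ext g))).real {ω | (q : EReal) ≤ M.totalWealth ω}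
  refine ⟨ext g, fun π => ?_⟩
  set p := (M.law (M.rulePolicy (ext g))).real {ω | (q : EReal) ≤ M.totalWealth ω}
  have hβ : ∀ β : ℝ, 0 ≤ β → β < 1 → M.discountedValue β q M.s₀ 0 ≤ p := by
    intro β h0 h1
    choose γ hγ using M.exists_stepValue_eq_bestValue (M.discountedValue β q)
    refine le_trans (M.discountedValue_le_law_real hr h0 h1 fun t h s hw => ?_)
      (hg fun x => γ x.1 x.2)
    have hpos : 0 ≤ M.wealth h := Finset.sum_nonneg fun i _ => hr _ _
    have hmem : M.wealth h ∈ M.wealthLevels |q| :=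
      ⟨by rw [abs_of_nonneg hpos]; exact hw.le.trans (le_abs_self q), t, h, rfl⟩
    simp only [ext, hmem, dif_pos, hγ]
    exact M.discountedValue_le_bestValue q h0 h1.le s hw
  have hmax : ∀ n, M.maxProb q n M.s₀ 0 ≤ p := by
    intro n
    have hc : Tendsto (fun β : ℝ => β ^ n * M.maxProb q n M.s₀ 0) (𝓝[<] 1)
        (𝓝 (1 ^ n * M.maxProb q n M.s₀ 0)) :=
      ((continuous_pow n).mul continuous_const).continuousAt.tendsto.mono_left nhdsWithin_le_nhds
    rw [one_pow, one_mul] at hc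
    refine le_of_tendsto hc ?_
    filter_upwards [Ioo_mem_nhdsLT (zero_lt_one' ℝ)] with β hβ'
    exact ((M.pow_mul_maxProb_le_discountedProb q hβ'.1.le hβ'.2.le n _ _).trans
      (M.discountedProb_le_discountedValue q hβ'.1.le hβ'.2.le _ _ _)).trans (hβ β hβ'.1.le hβ'.2)
  have hset : {ω : ℕ → S × A | (q : EReal) ≤ M.totalWealth ω}
      = ⋃ n, {ω | q ≤ M.wealth fun i : Fin n => ω i} := by
    ext ω
    simp [M.le_totalWealth_iff_of_nonneg hr]
  have ht := tendsto_measure_iUnion_atTop (μ := M.law π)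
    (s := fun n => {ω : ℕ → S × A | q ≤ M.wealth fun i : Fin n => ω i})
    fun _ _ hij ω hω => le_trans hω (M.monotone_wealth_of_nonneg hr ω hij)
  rw [← hset] at ht
  exact le_of_tendsto' ((ENNReal.tendsto_toReal (measure_ne_top _ _)).comp ht) fun n =>
    (M.law_real_wealth_le_maxProb π q n).trans (hmax n)

/-- Whether the rewards are nonpositive or nonnegative, some decision rule maximizes the
probability that the total wealth is at least `q`. -/
theorem exists_rule_forall_law_le [Nonempty A]
    (hr : (∀ s a, 0 ≤ M.r s a) ∨ ∀ s a, M.r s a ≤ 0) (q : ℝ) :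
    ∃ δ : S → ℝ → A, ∀ π : Policy S A, M.decumulative π q ≤ M.decumulative (M.rulePolicy δ) q :=
  hr.elim (fun h => M.exists_rule_forall_law_le_of_nonneg h q)
    fun h => M.exists_rule_forall_law_le_of_nonpos h q

end MDP

namespace MDP

/-! ### Quantiles and decumulative probabilities -/

variable {S A : Type*} [Finite S] [Finite A] [MeasurableSpace S] [DiscreteMeasurableSpace S]
  [MeasurableSpace A] [DiscreteMeasurableSpace A] (M : MDP S A)

theorem lt_decumulative_of_lt_lowerQuantile {τ : ℝ} {π : Policy S A} {q' q : EReal}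
    (hgap : ∀ ω : ℕ → S × A, q' < M.totalWealth ω → q ≤ M.totalWealth ω)
    (h : q' < M.lowerQuantile τ π) : 1 - τ < M.decumulative π q := by
  have h1 : M.cumulative π q' < τ := not_le.1 fun hle =>
    (sInf_le (show q' ∈ {w | τ ≤ M.cumulative π w} from hle)).not_gt h
  have h2 : (M.law π).real {ω | M.totalWealth ω ≤ q'}ᶜ = 1 - M.cumulative π q' :=
    probReal_compl_eq_one_sub (M.measurable_totalWealth measurableSet_Iic)
  have h3 : (M.law π).real {ω | M.totalWealth ω ≤ q'}ᶜ ≤ M.decumulative π q :=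
    measureReal_mono fun ω hω => hgap ω (not_le.1 hω)
  linarith

theorem le_lowerQuantile_of_lt_decumulative {τ : ℝ} {π : Policy S A} {q : EReal}
    (h : 1 - τ < M.decumulative π q) : q ≤ M.lowerQuantile τ π := by
  refine le_sInf fun w hw => not_lt.1 fun hlt => ?_
  have h1 : (M.law π).real {ω | M.totalWealth ω ≤ w}ᶜ = 1 - M.cumulative π w :=
    probReal_compl_eq_one_sub (M.measurable_totalWealth measurableSet_Iic)
  have h2 : M.decumulative π q ≤ (M.law π).real {ω | M.totalWealth ω ≤ w}ᶜ :=
    measureReal_mono fun ω hω => not_le.2 (hlt.trans_le hω)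
  have h3 : τ ≤ M.cumulative π w := hw
  linarith

theorem le_decumulative_of_lt_upperQuantile {τ : ℝ} {π : Policy S A} {q' q : EReal}
    (hgap : ∀ ω : ℕ → S × A, q' < M.totalWealth ω → q ≤ M.totalWealth ω)
    (h : q' < M.upperQuantile τ π) : 1 - τ ≤ M.decumulative π q := by
  obtain ⟨w, hw, hlt⟩ := lt_sSup_iff.1 h
  exact le_trans hw (measureReal_mono fun ω hω => hgap ω (hlt.trans_le hω))

theorem le_upperQuantile_of_le_decumulative {τ : ℝ} {π : Policy S A} {q : EReal}
    (h : 1 - τ ≤ M.decumulative π q) : q ≤ M.upperQuantile τ π :=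
  le_sSup h

theorem lowerQuantile_nonpos (hr : ∀ s a, M.r s a ≤ 0) {τ : ℝ} (hτ : τ ≤ 1) (π : Policy S A) :
    M.lowerQuantile τ π ≤ 0 :=
  sInf_le <| by simpa [cumulative, M.totalWealth_nonpos hr] using hτ

theorem upperQuantile_nonpos (hr : ∀ s a, M.r s a ≤ 0) {τ : ℝ} (hτ : τ < 1) (π : Policy S A) :
    M.upperQuantile τ π ≤ 0 := by
  refine sSup_le fun w hw => not_lt.1 fun hlt => ?_
  have h0 : {ω : ℕ → S × A | w ≤ M.totalWealth ω} = ∅ :=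
    Set.eq_empty_of_forall_notMem fun ω hω =>
      (hlt.trans_le hω).not_ge (M.totalWealth_nonpos hr ω)
  have h1 : 1 - τ ≤ M.decumulative π w := hw
  rw [decumulative, h0, measureReal_empty] at h1
  linarith

/-- Optimality for a criterion `Q` that is controlled by the decumulative probabilities: `good` is
the upper set of probabilities that witness `q ≤ Q π`. -/
theorem exists_optimal_of_decumulative [Nonempty A]
    (hr : (∀ s a, 0 ≤ M.r s a) ∨ ∀ s a, M.r s a ≤ 0) {Q : Policy S A → EReal} {good : Set ℝ}
    (hgood : IsUpperSet good)
    (h1 : ∀ {π : Policy S A} {q' q : EReal},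
      (∀ ω : ℕ → S × A, q' < M.totalWealth ω → q ≤ M.totalWealth ω) → q' < Q π →
        M.decumulative π q ∈ good)
    (h2 : ∀ {π : Policy S A} {q : EReal}, M.decumulative π q ∈ good → q ≤ Q π)
    {B : ℝ} (hB : ⨆ π, Q π ≤ (B : EReal)) :
    ∃ π : Policy S A, M.IsStationaryDeterministicWealthMarkovian π ∧
      IsGreatest (Set.range Q) (Q π) := by
  cases nonempty_fintype S
  cases nonempty_fintype A
  suffices h : ∃ δ : S → ℝ → A, ⨆ π, Q π ≤ Q (M.rulePolicy δ) by
    obtain ⟨δ, hδ⟩ := h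
    exact ⟨M.rulePolicy δ, ⟨δ, fun _ _ _ => rfl⟩, Set.mem_range_self _,
      Set.forall_mem_range.2 fun π => (le_iSup Q π).trans hδ⟩
  by_cases hbot : ⨆ π, Q π = ⊥
  · exact ⟨fun _ _ => Classical.arbitrary A, by simp [hbot]⟩
  obtain ⟨q, hq⟩ : ∃ q : ℝ, (q : EReal) = ⨆ π, Q π :=
    ⟨_, EReal.coe_toReal (hB.trans_lt (EReal.coe_lt_top B)).ne hbot⟩
  obtain ⟨q', hlt, hgap⟩ := M.exists_lt_forall_totalWealth hr q
  obtain ⟨π, hπ⟩ := lt_iSup_iff.1 (hq ▸ EReal.coe_lt_coe_iff.2 hlt : (q' : EReal) < ⨆ π, Q π)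
  obtain ⟨δ, hδ⟩ := M.exists_rule_forall_law_le hr q
  exact ⟨δ, hq ▸ h2 (hgood (hδ π) (h1 hgap hπ))⟩

theorem exists_lowerOptimal [Nonempty A] (hr : (∀ s a, 0 ≤ M.r s a) ∨ ∀ s a, M.r s a ≤ 0)
    {τ B : ℝ} (hB : ⨆ π, M.lowerQuantile τ π ≤ (B : EReal)) :
    ∃ π : Policy S A, M.IsStationaryDeterministicWealthMarkovian π ∧ M.IsLowerOptimal τ π :=
  M.exists_optimal_of_decumulative hr (isUpperSet_Ioi (1 - τ))
    M.lt_decumulative_of_lt_lowerQuantile M.le_lowerQuantile_of_lt_decumulative hB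

theorem exists_upperOptimal [Nonempty A] (hr : (∀ s a, 0 ≤ M.r s a) ∨ ∀ s a, M.r s a ≤ 0)
    {τ B : ℝ} (hB : ⨆ π, M.upperQuantile τ π ≤ (B : EReal)) :
    ∃ π : Policy S A, M.IsStationaryDeterministicWealthMarkovian π ∧ M.IsUpperOptimal τ π :=
  M.exists_optimal_of_decumulative hr (isUpperSet_Ici (1 - τ))
    M.le_decumulative_of_lt_upperQuantile M.le_upperQuantile_of_le_decumulative hB

end MDP

end QuantileMDP

end

theorem proposition3 {S A : Type*} [Finite S] [Finite A] [Nonempty A]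
    [MeasurableSpace S] [DiscreteMeasurableSpace S]
    [MeasurableSpace A] [DiscreteMeasurableSpace A] (M : QuantileMDP.MDP S A) :
    -- case (i): all rewards are nonpositive
    ((∀ s a, M.r s a ≤ 0) →
      (∀ τ ∈ Set.Ioc (0 : ℝ) 1, ∃ π : QuantileMDP.Policy S A,
        M.IsStationaryDeterministicWealthMarkovian π ∧ M.IsLowerOptimal τ π) ∧
      (∀ τ ∈ Set.Ico (0 : ℝ) 1, ∃ π : QuantileMDP.Policy S A,
        M.IsStationaryDeterministicWealthMarkovian π ∧ M.IsUpperOptimal τ π)) ∧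
    -- case (ii): all rewards are nonnegative and the optimal quantile has a finite upper bound
    ((∀ s a, 0 ≤ M.r s a) →
      (∀ τ ∈ Set.Ioc (0 : ℝ) 1,
        (∃ B : ℝ, (⨆ π : QuantileMDP.Policy S A, M.lowerQuantile τ π) ≤ (B : EReal)) →
        ∃ π : QuantileMDP.Policy S A,
          M.IsStationaryDeterministicWealthMarkovian π ∧ M.IsLowerOptimal τ π) ∧
      (∀ τ ∈ Set.Ico (0 : ℝ) 1,
        (∃ B : ℝ, (⨆ π : QuantileMDP.Policy S A, M.upperQuantile τ π) ≤ (B : EReal)) →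
        ∃ π : QuantileMDP.Policy S A,
          M.IsStationaryDeterministicWealthMarkovian π ∧ M.IsUpperOptimal τ π)) := by
  refine ⟨fun hr => ⟨fun τ hτ => ?_, fun τ hτ => ?_⟩, fun hr => ⟨fun τ _ ⟨B, hB⟩ => ?_,
    fun τ _ ⟨B, hB⟩ => ?_⟩⟩
  · exact M.exists_lowerOptimal (.inr hr) (B := 0) (iSup_le (M.lowerQuantile_nonpos hr hτ.2))
  · exact M.exists_upperOptimal (.inr hr) (B := 0) (iSup_le (M.upperQuantile_nonpos hr hτ.2))
  · exact M.exists_lowerOptimal (.inl hr) hB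
  · exact M.exists_upperOptimal (.inl hr) hB
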